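/- Let $(W,S)$ be a Coxeter system of finite rank $n=|S|$ with Coxeter matrix $(m_{ij})_{i,j\in S}$, $m_{ij}\in\mathbb{Z}_{>0}\cup\{\infty\}$. Let $V=\mathbb{R}^S$ with its standard orthonormal basis $\Delta=\{\alpha_i\}_{i\in S}$ and let $B$ be a symmetric bilinear form on $V$ with $B(\alpha_i,\alpha_j)=-\cos(\pi/m_{ij})$ if $m_{ij}<\infty$ and $B(\alpha_i,\alpha_j)\le -1$ if $m_{ij}=\infty$. Assume that $B$ has signature $(n-1,1)$ and that its Gram matrix $(B(\alpha_i,\alpha_j))$ is irreducible, i.e. not block-diagonal up to a permutation of the basis. Then the Gram matrix has exactly one eigenvector $o=\sum_i o_i\alpha_i$ for a negative eigenvalue that has Euclidean norm $1$ and all coordinates $o_i>0$. For $v=\sum_i v_i\alpha_i$ put $|v|_1=\sum_i o_iv_i$ and $q(v)=B(v,v)$; let $V_1=\{v: |v|_1=1\}$, $D=\{v\in V_1: q(v)<0\}$ and let $\partial D=\{v\in V_1: q(v)=0\}$ be the bounding ellipsoid. Let $\widehat\alpha_i=\alpha_i/|\alpha_i|_1$. For $I\subseteq S$ let $F_I=\mathrm{conv}\{\widehat\alpha_i: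 i\in I\}$, a face of the simplex $F_S=\mathrm{conv}(\widehat\Delta)$, let $W_I=\langle I\rangle\le W$, and let $B_I$ be the restriction of $B$ to the span of $\{\alpha_i:i\in I\}$. The face $F_I$ is called tangent to $\partial D$ if $F_I\cap\partial D\ne\emptyset$ and the affine span of $F_I$ does not meet $D$. Consider the cases (i) $D\cup\partial D\subseteq \mathrm{int}(\mathrm{conv}(\widehat\Delta))$, the interior being taken in $V_1$; (ii) some proper face $F_I$, $I\subsetneq S$, is tangent to $\partial D$; (iii) neither (i) nor (ii) holds. Then: (a) Case (i) holds if and only if $W_I$ is finite for every $I\subseteq S$ with $|I|=n-1$. (b) Case (ii) holds if and only if there is $I\subsetneq S$ such that $W_I$ is affine, i.e. $B_I$ has signature $(|I|-1,0)$. (c) Case (iii) holds if and only if, for every $I\subsetneq S$, the form $B_I$ has signature $(|I|-1,1)$ or is positive definite (signature $(|I|,0)$), and for at least one $I\subsetneq S$ it has signature $(|I|-1,1)$. -/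

import Mathlib

namespace CoxeterLorentz

open scoped Matrix

variable {S : Type*}

/-- `A` is a Gram matrix for the Coxeter matrix `M` (in which the entry `0` stands for `∞`):
a real symmetric matrix with `A i j = -cos (π / m i j)` if `m i j` is finite and `A i j ≤ -1` if
`m i j = ∞`. As `m i i = 1`, the diagonal entries are `1`. -/
structure IsGramMatrix (M : CoxeterMatrix S) (A : Matrix S S ℝ) : Prop where
  symm : A.IsSymm
  finite_entry : ∀ i j, M i j ≠ 0 → A i j = -Real.cos (Real.pi / (M i j : ℝ))
  infinite_entry : ∀ i j, M i j = 0 → A i j ≤ -1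

/-- `A` is not block-diagonal (with at least two blocks) up to a permutation of the basis. -/
def IsIndecomposable (A : Matrix S S ℝ) : Prop :=
  ∀ I : Set S, I.Nonempty → Iᶜ.Nonempty → ∃ i ∈ I, ∃ j ∈ Iᶜ, A i j ≠ 0

variable [Fintype S] [DecidableEq S]

/-- The quadratic form `v ↦ vᵀ A v` has `p` positive and `q` negative directions. -/
def HasSignature (A : Matrix S S ℝ) (p q : ℕ) : Prop :=
  sigPos A.toQuadraticForm' = p ∧ sigNeg A.toQuadraticForm' = q

/-- Type `(n - 1, 1)`, where `n` is the size of the matrix. -/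
def IsLorentzian (A : Matrix S S ℝ) : Prop :=
  ∃ p : ℕ, p + 1 = Fintype.card S ∧ HasSignature A p 1

/-- Signature `(n - 1, 0)`, where `n` is the size of the matrix. -/
def IsAffine (A : Matrix S S ℝ) : Prop :=
  ∃ p : ℕ, p + 1 = Fintype.card S ∧ HasSignature A p 0

/-- Signature `(n, 0)`, where `n` is the size of the matrix. -/
def IsPositive (A : Matrix S S ℝ) : Prop :=
  HasSignature A (Fintype.card S) 0

/-- The principal submatrix with index set `I`: the Gram matrix of the standard Coxeter subsystem
generated by `I`. -/
def principal (A : Matrix S S ℝ) (I : Finset S) : Matrix I I ℝ :=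
  A.submatrix (fun i => (i : S)) (fun i => (i : S))

/-- `o` is an eigenvector of `A` for a negative eigenvalue, of Euclidean norm `1` and with all
coordinates positive. -/
def IsNormalizedEigenvector (A : Matrix S S ℝ) (o : EuclideanSpace ℝ S) : Prop :=
  (∃ μ : ℝ, μ < 0 ∧ A *ᵥ o.ofLp = μ • o.ofLp) ∧ ‖o‖ = 1 ∧ ∀ i, 0 < o i

/-- The simple root `α_i`: the simple roots are the standard orthonormal basis. -/
noncomputable def simpleRoot (i : S) : EuclideanSpace ℝ S :=
  EuclideanSpace.single i 1

/-- `|v|₁ = ∑ o_i v_i`. -/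
def height (o v : EuclideanSpace ℝ S) : ℝ :=
  ∑ i, o i * v i

/-- The normalization `v / |v|₁` of `v`. -/
noncomputable def normalize (o v : EuclideanSpace ℝ S) : EuclideanSpace ℝ S :=
  (height o v)⁻¹ • v

/-- `q(v) = B(v, v)`, where `B` has the matrix `A` in the basis of simple roots. -/
noncomputable def q (A : Matrix S S ℝ) (v : EuclideanSpace ℝ S) : ℝ :=
  A.toQuadraticForm' v.ofLp

/-- The open ellipsoid `D`: the points with `q < 0` in the affine hyperplane `|v|₁ = 1`. -/
def openEllipsoid (A : Matrix S S ℝ) (o : EuclideanSpace ℝ S) : Set (EuclideanSpace ℝ S) :=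
  {v | height o v = 1 ∧ q A v < 0}

/-- Its boundary `∂D`: the points with `q = 0` in the affine hyperplane `|v|₁ = 1`. -/
def ellipsoid (A : Matrix S S ℝ) (o : EuclideanSpace ℝ S) : Set (EuclideanSpace ℝ S) :=
  {v | height o v = 1 ∧ q A v = 0}

/-- The face of the simplex spanned by the normalized simple roots with index in `I`; the whole
simplex for `I = univ`. -/
def face (o : EuclideanSpace ℝ S) (I : Finset S) : Set (EuclideanSpace ℝ S) :=
  convexHull ℝ ((fun i => normalize o (simpleRoot i)) '' (I : Set S))

/-- The face with vertex set `I` is tangent to the ellipsoid: it touches the ellipsoid, and its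
affine span does not enter the open region bounded by the ellipsoid. -/
def IsTangentFace (A : Matrix S S ℝ) (o : EuclideanSpace ℝ S) (I : Finset S) : Prop :=
  (face o I ∩ ellipsoid A o).Nonempty ∧
    (affineSpan ℝ (face o I) : Set (EuclideanSpace ℝ S)) ∩ openEllipsoid A o = ∅

/-- Case (i): the closed ellipsoid lies in the interior of the simplex. The interior is taken in
the affine hyperplane `|v|₁ = 1`, the affine span of the simplex. -/
def CaseInside (A : Matrix S S ℝ) (o : EuclideanSpace ℝ S) : Prop :=
  openEllipsoid A o ∪ ellipsoid A o ⊆ intrinsicInterior ℝ (face o Finset.univ)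

/-- Case (ii): some proper face of the simplex is tangent to the ellipsoid. -/
def CaseTangent (A : Matrix S S ℝ) (o : EuclideanSpace ℝ S) : Prop :=
  ∃ I : Finset S, I ≠ Finset.univ ∧ IsTangentFace A o I

/-- Case (iii): the remaining case. -/
def CaseRemaining (A : Matrix S S ℝ) (o : EuclideanSpace ℝ S) : Prop :=
  ¬ CaseInside A o ∧ ¬ CaseTangent A o

/-- The standard parabolic subgroup generated by the simple reflections with index in `I`. -/
def parabolic {M : CoxeterMatrix S} {W : Type*} [Group W] (cs : CoxeterSystem M W)
    (I : Finset S) : Subgroup W :=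
  Subgroup.closure (cs.simple '' (I : Set S))

end CoxeterLorentz

/-! As `A` is symmetric, the Euclidean complement of `o` is also its `B`-complement, and signature
`(n-1,1)` makes `B` positive definite there (`IsLorentzian.pos_of_dotProduct_eq_zero`). So every
`B_I` is positive definite on the kernel of a linear form; it is then positive definite, affine or
Lorentzian, according to whether `q` is positive off `0`, nonnegative with a nontrivial zero, or
somewhere negative.

Because off-diagonal entries are nonpositive, passing from `x` to `|x|` does not raise `q`. A vector
supported on `I` with `q ≤ 0` or `q < 0` thus yields a point of `F_I` with the same property
(`exists_mem_face_q_le`). Hence tangent faces are exactly the affine ones (`isTangentFace_iff`), and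
(i) fails if some proper `B_I` is not positive definite. Conversely, a point of the closed ellipsoid
with a nonpositive coordinate can be pushed along `o` onto a coordinate hyperplane without raising
`q` (`caseInside_iff`). Part (c) follows by exclusion.

For (a) it remains that `W_I` is finite exactly when `B_I` is positive definite
(`IsGramMatrix.finite_parabolic_iff`). If `W_I` is finite, a Perron eigenvector of `B_I` with
eigenvalue `≤ 0` would have nonpositive norm for an averaged inner product. If `B_I` is positive
definite, the images of the simple roots are bounded, while distinct group elements stay uniformly
apart because a nontrivial element makes some simple root negative
(`IsGramMatrix.rep_single_nonpos`); compactness gives finiteness. -/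

namespace CoxeterLorentz

open scoped Matrix

/-! ### Perron vectors and signatures of symmetric real matrices. -/

section LinearAlgebra

variable {T : Type*} [Fintype T]

theorem dotProduct_mulVec_eq_sum (A : Matrix T T ℝ) (x y : T → ℝ) :
    x ⬝ᵥ A *ᵥ y = ∑ i, ∑ j, A i j * (x i * y j) := by
  simp only [dotProduct, Matrix.mulVec, Finset.mul_sum]
  exact Finset.sum_congr rfl fun i _ => Finset.sum_congr rfl fun j _ => by ring

theorem dotProduct_mulVec_symm {A : Matrix T T ℝ} (hA : A.IsSymm) (x y : T → ℝ) :
    x ⬝ᵥ A *ᵥ y = y ⬝ᵥ A *ᵥ x := by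
  rw [Matrix.dotProduct_mulVec, ← Matrix.mulVec_transpose, hA.eq, dotProduct_comm]

theorem toQuadraticForm'_apply [DecidableEq T] (A : Matrix T T ℝ) (x : T → ℝ) :
    A.toQuadraticForm' x = x ⬝ᵥ A *ᵥ x := by
  simp [Matrix.toQuadraticForm', Matrix.toLinearMap₂'_apply']

/-- Replacing a vector by its absolute value does not increase the quadratic form of a matrix
with nonpositive off-diagonal entries. -/
theorem abs_dotProduct_mulVec_abs_le {A : Matrix T T ℝ} (hA : ∀ i j, i ≠ j → A i j ≤ 0)
    (x : T → ℝ) : |x| ⬝ᵥ A *ᵥ |x| ≤ x ⬝ᵥ A *ᵥ x := by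
  rw [dotProduct_mulVec_eq_sum, dotProduct_mulVec_eq_sum]
  refine Finset.sum_le_sum fun i _ => Finset.sum_le_sum fun j _ => ?_
  rcases eq_or_ne i j with rfl | hij
  · simp [Pi.abs_apply]
  · refine mul_le_mul_of_nonpos_left ?_ (hA i j hij)
    rw [Pi.abs_apply, Pi.abs_apply, ← abs_mul]
    exact le_abs_self _

theorem dotProduct_self_pos {x : T → ℝ} (hx : x ≠ 0) : 0 < x ⬝ᵥ x := by
  refine lt_of_le_of_ne (Finset.sum_nonneg fun i _ => mul_self_nonneg _) fun h => hx ?_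
  exact dotProduct_self_eq_zero.1 h.symm

/-- The quadratic form of a real matrix attains its minimum on the unit sphere. -/
theorem exists_isMin_rayleigh [Nonempty T] (A : Matrix T T ℝ) :
    ∃ w : T → ℝ, w ≠ 0 ∧ ∃ μ : ℝ, w ⬝ᵥ A *ᵥ w = μ * (w ⬝ᵥ w) ∧
      ∀ x : T → ℝ, μ * (x ⬝ᵥ x) ≤ x ⬝ᵥ A *ᵥ x := by
  classical
  have hc : Continuous fun x : T → ℝ => x ⬝ᵥ A *ᵥ x := by
    unfold dotProduct Matrix.mulVec dotProduct
    fun_prop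
  -- The norm on `T → ℝ` is the sup norm, so the scale-invariant quotient is minimised instead of
  -- the form.
  obtain ⟨w, hw, hmin⟩ := (isCompact_sphere (0 : T → ℝ) 1).exists_isMinOn
    (f := fun x : T → ℝ => (x ⬝ᵥ A *ᵥ x) / (x ⬝ᵥ x)) (NormedSpace.sphere_nonempty.2 zero_le_one) (by
      refine hc.continuousOn.div (by unfold dotProduct; fun_prop) fun x hx => ?_
      refine (dotProduct_self_pos ?_).ne'
      rintro rfl
      simp at hx)
  have hw0 : w ≠ 0 := by
    rintro rfl
    simp at hw
  refine ⟨w, hw0, (w ⬝ᵥ A *ᵥ w) / (w ⬝ᵥ w), ?_, fun x => ?_⟩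
  · rw [div_mul_cancel₀ _ (dotProduct_self_pos hw0).ne']
  · rcases eq_or_ne x 0 with rfl | hx
    · simp
    · have hn : 0 < ‖x‖ := norm_pos_iff.2 hx
      have h := isMinOn_iff.1 hmin (‖x‖⁻¹ • x) (by simp [norm_smul, hn.ne'])
      rw [← le_div_iff₀ (dotProduct_self_pos hx)]
      refine h.trans_eq ?_
      simp only [Matrix.mulVec_smul, smul_dotProduct, dotProduct_smul, smul_eq_mul]
      have := (dotProduct_self_pos hx).ne'
      field_simp

/-- Perron's theorem for a symmetric matrix with nonpositive off-diagonal entries: the smallest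
eigenvalue has a nonnegative eigenvector. -/
theorem exists_nonneg_eigenvector [Nonempty T] {A : Matrix T T ℝ} (hS : A.IsSymm)
    (hA : ∀ i j, i ≠ j → A i j ≤ 0) :
    ∃ (v : T → ℝ) (μ : ℝ), v ≠ 0 ∧ (∀ i, 0 ≤ v i) ∧ A *ᵥ v = μ • v ∧
      ∀ x : T → ℝ, μ * (x ⬝ᵥ x) ≤ x ⬝ᵥ A *ᵥ x := by
  classical
  obtain ⟨w, hw0, μ, hw, hmin⟩ := exists_isMin_rayleigh A
  refine ⟨|w|, μ, by simpa using hw0, fun i => abs_nonneg _, ?_, hmin⟩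
  have hform (x : T → ℝ) : x ⬝ᵥ (A - μ • (1 : Matrix T T ℝ)) *ᵥ x
      = x ⬝ᵥ A *ᵥ x - μ * (x ⬝ᵥ x) := by
    simp [Matrix.sub_mulVec, Matrix.smul_mulVec, dotProduct_sub]
  have hsymm : (A - μ • (1 : Matrix T T ℝ)).IsSymm := hS.sub (Matrix.isSymm_one.smul μ)
  have hpsd : (A - μ • (1 : Matrix T T ℝ)).PosSemidef := by
    refine Matrix.PosSemidef.of_dotProduct_mulVec_nonneg ?_ fun x => ?_
    · rw [Matrix.IsHermitian, Matrix.conjTranspose_eq_transpose_of_trivial, hsymm.eq]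
    · rw [star_trivial, hform]
      exact sub_nonneg.2 (hmin x)
  have habs : |w| ⬝ᵥ |w| = w ⬝ᵥ w :=
    Finset.sum_congr rfl fun i _ => abs_mul_abs_self _
  -- `|w|` is again a minimiser, hence isotropic for the semidefinite `A - μ`, hence in its kernel.
  have h0 := (hpsd.dotProduct_mulVec_zero_iff |w|).1 (by
    rw [star_trivial, hform]
    refine le_antisymm ?_ (sub_nonneg.2 (hmin _))
    rw [habs, ← hw]
    exact sub_nonpos.2 (abs_dotProduct_mulVec_abs_le hA w))
  rw [Matrix.sub_mulVec, Matrix.smul_mulVec, Matrix.one_mulVec, sub_eq_zero] at h0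
  exact h0

/-- A nonnegative nonzero eigenvector of an indecomposable matrix with nonpositive off-diagonal
entries is positive. -/
theorem IsIndecomposable.eigenvector_pos {A : Matrix T T ℝ} (hI : IsIndecomposable A)
    (hA : ∀ i j, i ≠ j → A i j ≤ 0) {v : T → ℝ} {μ : ℝ} (hv : v ≠ 0)
    (hnn : ∀ i, 0 ≤ v i) (he : A *ᵥ v = μ • v) (i : T) : 0 < v i := by
  by_contra hi
  have hi : v i = 0 := le_antisymm (not_lt.1 hi) (hnn i)
  obtain ⟨k, hk⟩ := Function.ne_iff.1 hv
  obtain ⟨a, ha, b, hb, hab⟩ := hI {j | v j = 0} ⟨i, hi⟩ ⟨k, hk⟩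
  have ha : v a = 0 := ha
  have hb : v b ≠ 0 := hb
  have h := congrFun he a
  rw [Pi.smul_apply, ha, smul_zero] at h
  -- Row `a` of the eigenvalue equation is a sum of nonpositive terms equal to `0`, so each term
  -- vanishes.
  have hterm : ∀ j ∈ Finset.univ, A a j * v j ≤ 0 := fun j _ => by
    rcases eq_or_ne a j with rfl | haj
    · simp [ha]
    · exact mul_nonpos_of_nonpos_of_nonneg (hA a j haj) (hnn j)
  exact mul_ne_zero hab hb ((Finset.sum_eq_zero_iff_of_nonpos hterm).1 h b (Finset.mem_univ b))

variable [DecidableEq T]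

theorem sigNeg_eq_zero_iff {A : Matrix T T ℝ} :
    sigNeg A.toQuadraticForm' = 0 ↔ ∀ x : T → ℝ, 0 ≤ x ⬝ᵥ A *ᵥ x := by
  constructor
  · intro h x
    by_contra! hx
    have hx0 : x ≠ 0 := by
      rintro rfl
      simp at hx
    have := le_sigNeg_of_negDef (Q := A.toQuadraticForm') (V := ℝ ∙ x) (by
      rintro ⟨y, hy⟩ hy0
      obtain ⟨c, rfl⟩ := Submodule.mem_span_singleton.1 hy
      have hc : c ≠ 0 := by
        rintro rfl
        simp at hy0
      simp only [QuadraticMap.restrict_apply, neg_apply, QuadraticMap.map_smul,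
        toQuadraticForm'_apply, smul_eq_mul]
      have := mul_pos (mul_self_pos.2 hc) (neg_pos.2 hx)
      linarith)
    rw [finrank_span_singleton hx0] at this
    omega
  · intro h
    obtain ⟨V, hV, hd⟩ := exists_finrank_eq_sigNeg_and_negDef A.toQuadraticForm'
    rw [← hV, Submodule.finrank_eq_zero, Submodule.eq_bot_iff]
    intro x hx
    by_contra hx0
    have := hd ⟨x, hx⟩ (by simpa using hx0)
    simp only [QuadraticMap.restrict_apply, neg_apply, toQuadraticForm'_apply] at this
    linarith [h x]

theorem sigPos_eq_card_iff {A : Matrix T T ℝ} :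
    sigPos A.toQuadraticForm' = Fintype.card T ↔ ∀ x : T → ℝ, x ≠ 0 → 0 < x ⬝ᵥ A *ᵥ x := by
  constructor
  · intro h x hx
    obtain ⟨V, hV, hd⟩ := exists_finrank_eq_sigPos_and_posDef A.toQuadraticForm'
    have hT : V = ⊤ := Submodule.eq_top_of_finrank_eq
      (by rw [hV, h, Module.finrank_fintype_fun_eq_card])
    subst hT
    have := hd ⟨x, trivial⟩ (by simpa [Subtype.ext_iff] using hx)
    simpa only [QuadraticMap.restrict_apply, toQuadraticForm'_apply] using this
  · intro h
    refine le_antisymm ((sigPos_le_finrank _).trans_eq (Module.finrank_fintype_fun_eq_card ℝ)) ?_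
    have := le_sigPos_of_posDef (Q := A.toQuadraticForm') (V := ⊤) (by
      rintro ⟨x, _⟩ hx
      rw [QuadraticMap.restrict_apply, toQuadraticForm'_apply]
      exact h x (by simpa using hx))
    simpa using this

theorem isPositive_iff {A : Matrix T T ℝ} :
    IsPositive A ↔ ∀ x : T → ℝ, x ≠ 0 → 0 < x ⬝ᵥ A *ᵥ x := by
  refine ⟨fun h => sigPos_eq_card_iff.1 h.1, fun h => ⟨sigPos_eq_card_iff.2 h, ?_⟩⟩
  refine sigNeg_eq_zero_iff.2 fun x => ?_
  rcases eq_or_ne x 0 with rfl | hx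
  · simp
  · exact (h x hx).le

/-- A form that is positive definite on a hyperplane has at most one nonpositive direction. -/
theorem card_le_sigPos_add_one {A : Matrix T T ℝ} (ℓ : Module.Dual ℝ (T → ℝ))
    (hℓ : ∀ x : T → ℝ, ℓ x = 0 → x ≠ 0 → 0 < x ⬝ᵥ A *ᵥ x) :
    Fintype.card T ≤ sigPos A.toQuadraticForm' + 1 := by
  have h := le_sigPos_of_posDef (Q := A.toQuadraticForm') (V := LinearMap.ker ℓ) (by
    rintro ⟨x, hx⟩ hx0
    rw [QuadraticMap.restrict_apply, toQuadraticForm'_apply]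
    exact hℓ x hx (by simpa using hx0))
  have h2 := ℓ.finrank_range_add_finrank_ker
  have h3 : Module.finrank ℝ (LinearMap.range ℓ) ≤ 1 :=
    (Submodule.finrank_le _).trans_eq (Module.finrank_self ℝ)
  rw [Module.finrank_fintype_fun_eq_card] at h2
  omega

/-- The hyperplane forces at least `n - 1` positive directions, so a single negative vector
determines the whole signature. -/
theorem isLorentzian_iff {A : Matrix T T ℝ} (ℓ : Module.Dual ℝ (T → ℝ))
    (hℓ : ∀ x : T → ℝ, ℓ x = 0 → x ≠ 0 → 0 < x ⬝ᵥ A *ᵥ x) :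
    IsLorentzian A ↔ ∃ x : T → ℝ, x ⬝ᵥ A *ᵥ x < 0 := by
  have hneg : sigNeg A.toQuadraticForm' ≠ 0 ↔ ∃ x : T → ℝ, x ⬝ᵥ A *ᵥ x < 0 := by
    rw [Ne, sigNeg_eq_zero_iff]
    push Not
    rfl
  rw [← hneg]
  constructor
  · rintro ⟨p, -, -, h⟩
    omega
  · intro h
    have h1 := card_le_sigPos_add_one ℓ hℓ
    have h2 := QuadraticForm.sigPos_add_sigNeg_add_radical (Q := A.toQuadraticForm')
    rw [Module.finrank_fintype_fun_eq_card] at h2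
    exact ⟨sigPos A.toQuadraticForm', by omega, rfl, by omega⟩

theorem isAffine_iff {A : Matrix T T ℝ} (ℓ : Module.Dual ℝ (T → ℝ))
    (hℓ : ∀ x : T → ℝ, ℓ x = 0 → x ≠ 0 → 0 < x ⬝ᵥ A *ᵥ x) :
    IsAffine A ↔ (∀ x : T → ℝ, 0 ≤ x ⬝ᵥ A *ᵥ x) ∧ ∃ x : T → ℝ, x ≠ 0 ∧ x ⬝ᵥ A *ᵥ x = 0 := by
  constructor
  · rintro ⟨p, hp, hpos, hneg⟩
    have hnn := sigNeg_eq_zero_iff.1 hneg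
    refine ⟨hnn, ?_⟩
    by_contra! hx
    have := sigPos_eq_card_iff.2 fun x hx0 => lt_of_le_of_ne (hnn x) (hx x hx0).symm
    omega
  · rintro ⟨hnn, x, hx0, hx⟩
    have h0 := sigNeg_eq_zero_iff.2 hnn
    have h1 := card_le_sigPos_add_one ℓ hℓ
    have h2 := QuadraticForm.sigPos_add_sigNeg_add_radical (Q := A.toQuadraticForm')
    rw [Module.finrank_fintype_fun_eq_card] at h2
    have h3 : sigPos A.toQuadraticForm' ≠ Fintype.card T := fun h =>
      (sigPos_eq_card_iff.1 h x hx0).ne' hx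
    exact ⟨sigPos A.toQuadraticForm', by omega, rfl, h0⟩

/-- In a Lorentzian space, the complement of an eigenvector with a negative eigenvalue is positive
definite. -/
theorem IsLorentzian.pos_of_dotProduct_eq_zero {A : Matrix T T ℝ} (hL : IsLorentzian A)
    (hS : A.IsSymm) {o : T → ℝ} {μ : ℝ} (hμ : μ < 0) (ho : o ≠ 0) (he : A *ᵥ o = μ • o)
    {u : T → ℝ} (hu : u ≠ 0) (huo : o ⬝ᵥ u = 0) : 0 < u ⬝ᵥ A *ᵥ u := by
  by_contra! hq
  obtain ⟨p, hp, hpos, -⟩ := hL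
  have hli : LinearIndependent ℝ ![o, u] := by
    refine LinearIndependent.pair_iff.2 fun s t hst => ?_
    have h1 := congrArg (o ⬝ᵥ ·) hst
    have h2 := congrArg (u ⬝ᵥ ·) hst
    simp only [dotProduct_add, dotProduct_smul, huo, dotProduct_comm u o, smul_eq_mul, mul_zero,
      add_zero, zero_add, dotProduct_zero, mul_eq_zero, (dotProduct_self_pos ho).ne',
      (dotProduct_self_pos hu).ne', or_false] at h1 h2
    exact ⟨h1, h2⟩
  -- Otherwise `o` and `u` span a plane on which the form is nonpositive, too large next to `n - 1`
  -- positive directions.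
  have hle := QuadraticForm.sigPos_add_finrank_le_of_nonpos (Q := A.toQuadraticForm')
    (V := Submodule.span ℝ (Set.range ![o, u])) (by
      intro x hx
      rw [Matrix.range_cons_cons_empty] at hx
      obtain ⟨a, b, rfl⟩ := Submodule.mem_span_pair.1 hx
      have h1 : u ⬝ᵥ A *ᵥ o = 0 := by
        rw [he, dotProduct_smul, dotProduct_comm, huo, smul_zero]
      have h2 : o ⬝ᵥ A *ᵥ u = 0 := by rw [dotProduct_mulVec_symm hS, h1]
      have h3 : o ⬝ᵥ A *ᵥ o = μ * (o ⬝ᵥ o) := by rw [he, dotProduct_smul, smul_eq_mul]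
      have h4 : (a • o + b • u) ⬝ᵥ A *ᵥ (a • o + b • u)
          = a ^ 2 * (μ * (o ⬝ᵥ o)) + b ^ 2 * (u ⬝ᵥ A *ᵥ u) := by
        simp only [Matrix.mulVec_add, Matrix.mulVec_smul, add_dotProduct, dotProduct_add,
          smul_dotProduct, dotProduct_smul, smul_eq_mul, h1, h2, h3]
        ring
      rw [toQuadraticForm'_apply, h4]
      have := mul_nonneg (sq_nonneg a) (mul_nonneg (neg_nonneg.2 hμ.le) (dotProduct_self_pos ho).le)
      have := mul_nonneg (sq_nonneg b) (neg_nonneg.2 hq)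
      linarith)
  rw [finrank_span_eq_card hli, hpos, Module.finrank_fintype_fun_eq_card, Fintype.card_fin] at hle
  omega

end LinearAlgebra

/-! ### The geometric representation and its restriction to dihedral subgroups. -/

section Representation

variable {S : Type*} {M : CoxeterMatrix S} {A : Matrix S S ℝ}

theorem IsGramMatrix.diag (hA : IsGramMatrix M A) (i : S) : A i i = 1 := by
  rw [hA.finite_entry i i (by simp), M.diagonal]
  simp

theorem two_le_coxeterMatrix {i j : S} (hij : i ≠ j) (h0 : M i j ≠ 0) : 2 ≤ M i j := by
  have := M.off_diagonal i j hij
  omega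

theorem IsGramMatrix.nonpos (hA : IsGramMatrix M A) (i j : S) (hij : i ≠ j) : A i j ≤ 0 := by
  by_cases h0 : M i j = 0
  · linarith [hA.infinite_entry i j h0]
  · rw [hA.finite_entry i j h0, neg_nonpos]
    have h2 : (2 : ℝ) ≤ M i j := mod_cast two_le_coxeterMatrix hij h0
    have hpi := Real.pi_pos
    refine Real.cos_nonneg_of_mem_Icc ⟨?_, ?_⟩
    · have : 0 ≤ Real.pi / (M i j : ℝ) := by positivity
      linarith
    · exact div_le_div_of_nonneg_left hpi.le two_pos h2

/-- Both claims are carried together: `S_{k+1} = x S_k - S_{k-1} ≥ 2 S_k - S_{k-1} ≥ S_k`, starting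
from `S_{-1} = 0`. -/
theorem chebyshev_S_nonneg_and_mono {x : ℝ} (hx : 2 ≤ x) (k : ℕ) :
    0 ≤ (Polynomial.Chebyshev.S ℝ (k - 1)).eval x ∧
      (Polynomial.Chebyshev.S ℝ (k - 1)).eval x ≤ (Polynomial.Chebyshev.S ℝ k).eval x := by
  induction k with
  | zero => simp
  | succ k ih =>
    push_cast
    rw [add_sub_cancel_right, Polynomial.Chebyshev.S_add_one]
    simp only [Polynomial.eval_sub, Polynomial.eval_mul, Polynomial.eval_X]
    refine ⟨ih.1.trans ih.2, ?_⟩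
    nlinarith [ih.1, ih.2]

/-- These are the coefficients in `rep_alternatingWord`. For finite `m` they equal `sin (kπ/m) / sin
(π/m)`, whence the bound `k ≤ m`. -/
theorem IsGramMatrix.chebyshev_S_nonneg (hA : IsGramMatrix M A) {s t : S} (hst : s ≠ t) (k : ℕ)
    (hk : M s t ≠ 0 → k ≤ M s t) :
    0 ≤ (Polynomial.Chebyshev.S ℝ (k - 1)).eval (-2 * A s t) := by
  by_cases h0 : M s t = 0
  · exact (chebyshev_S_nonneg_and_mono (by linarith [hA.infinite_entry s t h0]) k).1
  · have h2 : (2 : ℝ) ≤ M s t := mod_cast two_le_coxeterMatrix hst h0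
    have hk : (k : ℝ) ≤ M s t := mod_cast hk h0
    have hpi := Real.pi_pos
    set θ := Real.pi / (M s t : ℝ) with hθ
    have hθ0 : 0 < θ := by positivity
    have hMθ : M s t * θ = Real.pi := by rw [hθ]; field_simp
    have hθpi : θ < Real.pi := by nlinarith
    have h := Polynomial.Chebyshev.S_two_mul_real_cos θ (k - 1)
    push_cast at h
    rw [sub_add_cancel] at h
    rw [hA.finite_entry s t h0, neg_mul_neg]
    refine nonneg_of_mul_nonneg_left ?_ (Real.sin_pos_of_pos_of_lt_pi hθ0 hθpi)
    rw [h]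
    refine Real.sin_nonneg_of_nonneg_of_le_pi (by positivity) ?_
    rw [← hMθ]
    exact mul_le_mul_of_nonneg_right hk hθ0.le

variable [Fintype S]

/-- The linear form `v ↦ 2 B(α_i, v)`. -/
noncomputable def coroot (A : Matrix S S ℝ) (i : S) : Module.Dual ℝ (S → ℝ) :=
  (2 : ℝ) • (LinearMap.proj i ∘ₗ A.mulVecLin)

theorem coroot_apply (A : Matrix S S ℝ) (i : S) (v : S → ℝ) : coroot A i v = 2 * (A *ᵥ v) i := rfl

variable [DecidableEq S]

theorem coroot_single (A : Matrix S S ℝ) (i j : S) :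
    coroot A i (Pi.single j 1) = 2 * A i j := by
  rw [coroot_apply, Matrix.mulVec_single_one]
  rfl

theorem IsGramMatrix.coroot_self (hA : IsGramMatrix M A) (i : S) :
    coroot A i (Pi.single i 1) = 2 := by
  rw [coroot_single, hA.diag, mul_one]

/-- The reflection in the simple root `α_i`. -/
noncomputable def IsGramMatrix.refl (hA : IsGramMatrix M A) (i : S) :
    (S → ℝ) ≃ₗ[ℝ] (S → ℝ) :=
  Module.reflection (hA.coroot_self i)

theorem IsGramMatrix.refl_apply (hA : IsGramMatrix M A) (i : S) (v : S → ℝ) :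
    hA.refl i v = v - (2 * (A *ᵥ v) i) • Pi.single i 1 :=
  Module.reflection_apply _ _

theorem chebyshev_S_eval_eq_zero {φ : ℝ} (hφ : Real.sin φ ≠ 0) {n : ℤ}
    (h : Real.sin ((n + 1) * φ) = 0) :
    (Polynomial.Chebyshev.S ℝ n).eval (2 * Real.cos φ) = 0 := by
  have := Polynomial.Chebyshev.S_two_mul_real_cos φ n
  rw [h] at this
  exact (mul_eq_zero.1 this).resolve_right hφ

theorem chebyshev_S_eval_add_eq_zero {φ : ℝ} (hφ : Real.sin φ ≠ 0) {n : ℤ}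
    (h : Real.sin ((n + 1) * φ) + Real.sin (n * φ) = 0) :
    (Polynomial.Chebyshev.S ℝ n).eval (2 * Real.cos φ) +
      (Polynomial.Chebyshev.S ℝ (n - 1)).eval (2 * Real.cos φ) = 0 := by
  have h1 := Polynomial.Chebyshev.S_two_mul_real_cos φ n
  have h2 := Polynomial.Chebyshev.S_two_mul_real_cos φ (n - 1)
  push_cast at h2
  rw [sub_add_cancel] at h2
  refine (mul_eq_zero.1 ?_).resolve_right hφ
  rw [add_mul, h1, h2, h]

/-- A product of two simple reflections acts on their plane as a rotation by `2π/m`; in the power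
formula this appears as the vanishing of Chebyshev values at `2 cos (2π/m)`. -/
theorem IsGramMatrix.isLiftable (hA : IsGramMatrix M A) : M.IsLiftable hA.refl := by
  intro i j
  rcases eq_or_ne i j with rfl | hij
  · rw [M.diagonal, pow_one]
    ext1 v
    exact Module.involutive_reflection (hA.coroot_self i) v
  by_cases h0 : M i j = 0
  · rw [h0, pow_zero]
  have h2 := two_le_coxeterMatrix hij h0
  have hcos := hA.finite_entry i j h0
  have hji : A j i = A i j := hA.symm.apply i j
  set m := M i j with hm
  ext1 v
  -- The parameter is the product of the two mixed pairings minus `2`: `4 cos² (π/m) - 2 = 2 cos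
  -- (2π/m)`.
  rw [IsGramMatrix.refl, IsGramMatrix.refl, Module.reflection_mul_reflection_pow_apply _ _ m v
    (2 * Real.cos (2 * (Real.pi / m))) (by
      rw [coroot_single, coroot_single, hji, hcos, Real.cos_two_mul]; ring)]
  rw [coroot_single, coroot_single, hji]
  have hm0 : (m : ℝ) ≠ 0 := mod_cast h0
  -- For `m = 2` the angle is `π`, whose sine cannot be divided by; there the roots are orthogonal.
  rcases eq_or_lt_of_le h2 with h2 | h3
  · rw [← h2] at hcos ⊢
    have hA0 : A i j = 0 := by simp [hcos]
    have hc : Real.cos (2 * (Real.pi / (2 : ℕ))) = -1 := by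
      rw [Nat.cast_ofNat, mul_div_cancel₀ _ (two_ne_zero), Real.cos_pi]
    rw [hA0, hc]
    norm_num
    abel
  · have hpi := Real.pi_pos
    have h3' : (3 : ℝ) ≤ m := mod_cast h3
    set φ := 2 * (Real.pi / (m : ℝ)) with hφ
    have hmφ : m * φ = 2 * Real.pi := by rw [hφ]; field_simp
    have hφ0 : 0 < φ := by positivity
    have hφpi : φ < Real.pi := by nlinarith
    have hs : Real.sin φ ≠ 0 := (Real.sin_pos_of_pos_of_lt_pi hφ0 hφpi).ne'
    obtain ⟨k, hk | hk⟩ := Nat.even_or_odd' m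
    · have hkφ : k * φ = Real.pi := by
        rw [hk] at hmφ; push_cast at hmφ; linarith
      have e1 : ((m : ℤ) - 2) / 2 = k - 1 := by omega
      have e2 : ((m : ℤ) - 1) / 2 = k - 1 := by omega
      have hS : (Polynomial.Chebyshev.S ℝ (k - 1)).eval (2 * Real.cos φ) = 0 :=
        chebyshev_S_eval_eq_zero hs (by push_cast; rw [sub_add_cancel, hkφ, Real.sin_pi])
      simp [e1, e2, hS]
    · have hkφ : (k + 1) * φ = Real.pi - (k * φ - Real.pi) := by
        rw [hk] at hmφ; push_cast at hmφ; linarith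
      have e1 : ((m : ℤ) - 2) / 2 = k - 1 := by omega
      have e2 : ((m : ℤ) - 1) / 2 = k := by omega
      have e3 : ((m : ℤ) - 3) / 2 = k - 1 := by omega
      have e4 : (m : ℤ) / 2 = k := by omega
      have hS : (Polynomial.Chebyshev.S ℝ k).eval (2 * Real.cos φ) +
          (Polynomial.Chebyshev.S ℝ (k - 1)).eval (2 * Real.cos φ) = 0 :=
        chebyshev_S_eval_add_eq_zero hs (by
          push_cast
          rw [hkφ, Real.sin_pi_sub, Real.sin_sub_pi, neg_add_cancel])
      simp [e1, e2, e3, e4, hS]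

variable {W : Type*} [Group W]

/-- The geometric representation of a Coxeter group. -/
noncomputable def IsGramMatrix.rep (hA : IsGramMatrix M A) (cs : CoxeterSystem M W) :
    W →* ((S → ℝ) ≃ₗ[ℝ] (S → ℝ)) :=
  cs.lift ⟨hA.refl, hA.isLiftable⟩

theorem IsGramMatrix.rep_simple (hA : IsGramMatrix M A) (cs : CoxeterSystem M W) (i : S) :
    hA.rep cs (cs.simple i) = hA.refl i :=
  cs.lift_apply_simple hA.isLiftable i

theorem IsGramMatrix.rep_simple_apply (hA : IsGramMatrix M A) (cs : CoxeterSystem M W) (i : S)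
    (v : S → ℝ) : hA.rep cs (cs.simple i) v = v - (2 * (A *ᵥ v) i) • Pi.single i 1 := by
  rw [hA.rep_simple, hA.refl_apply]

theorem IsGramMatrix.rep_mul_simple_single (hA : IsGramMatrix M A) (cs : CoxeterSystem M W)
    (w : W) (i : S) :
    hA.rep cs (w * cs.simple i) (Pi.single i 1) = -hA.rep cs w (Pi.single i 1) := by
  rw [map_mul, LinearEquiv.mul_apply, hA.rep_simple, IsGramMatrix.refl,
    Module.reflection_apply_self, map_neg]

/-- The geometric representation preserves the form. -/
theorem IsGramMatrix.form_rep (hA : IsGramMatrix M A) (cs : CoxeterSystem M W) (w : W)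
    (v : S → ℝ) : hA.rep cs w v ⬝ᵥ A *ᵥ hA.rep cs w v = v ⬝ᵥ A *ᵥ v := by
  induction w using cs.simple_induction_left generalizing v with
  | one => simp
  | mul_simple_left w i ih =>
    rw [map_mul, LinearEquiv.mul_apply]
    rw [← ih v]
    generalize hA.rep cs w v = u
    rw [hA.rep_simple_apply]
    have h1 : Pi.single i (1 : ℝ) ⬝ᵥ A *ᵥ u = (A *ᵥ u) i := by simp
    have h2 : u ⬝ᵥ A *ᵥ Pi.single i (1 : ℝ) = (A *ᵥ u) i := by
      rw [dotProduct_mulVec_symm hA.symm, h1]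
    have h3 : Pi.single i (1 : ℝ) ⬝ᵥ A *ᵥ Pi.single i (1 : ℝ) = 1 := by
      simp [hA.diag]
    simp only [Matrix.mulVec_sub, Matrix.mulVec_smul, sub_dotProduct, dotProduct_sub,
      smul_dotProduct, dotProduct_smul, smul_eq_mul, h1, h2, h3]
    ring

open Polynomial in
/-- The action of an alternating word on a simple root. -/
theorem IsGramMatrix.rep_alternatingWord (hA : IsGramMatrix M A) (cs : CoxeterSystem M W)
    (s t : S) (n : ℕ) :
    hA.rep cs (cs.wordProd (CoxeterSystem.alternatingWord s t n)) (Pi.single s 1) =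
      if Even n then
        (Chebyshev.S ℝ n).eval (-2 * A s t) • Pi.single s 1 + (Chebyshev.S ℝ (n - 1)).eval (-2 * A s t) • Pi.single t 1
      else
        (Chebyshev.S ℝ (n - 1)).eval (-2 * A s t) • Pi.single s 1 +
          (Chebyshev.S ℝ n).eval (-2 * A s t) • Pi.single t 1 := by
  have hts : A t s = A s t := hA.symm.apply s t
  induction n with
  | zero => simp [CoxeterSystem.alternatingWord]
  | succ n ih =>
    have hrec : (Chebyshev.S ℝ (n + 1)).eval (-2 * A s t)
        = -2 * A s t * (Chebyshev.S ℝ n).eval (-2 * A s t) - (Chebyshev.S ℝ (n - 1)).eval (-2 * A s t) := by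
      rw [Chebyshev.S_add_one]; simp
    rw [CoxeterSystem.alternatingWord_succ', cs.wordProd_cons, map_mul, LinearEquiv.mul_apply, ih]
    push_cast
    rw [add_sub_cancel_right, hrec]
    by_cases hn : Even n
    · rw [if_pos hn, if_pos hn, if_neg (by simpa [Nat.even_add_one] using hn), hA.rep_simple_apply]
      have : (A *ᵥ ((Chebyshev.S ℝ n).eval (-2 * A s t) • Pi.single s 1 +
          (Chebyshev.S ℝ (n - 1)).eval (-2 * A s t) • Pi.single t 1)) t =
          (Chebyshev.S ℝ n).eval (-2 * A s t) * A s t + (Chebyshev.S ℝ (n - 1)).eval (-2 * A s t) := by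
        simp [Matrix.mulVec_add, Matrix.mulVec_smul, hA.diag, hts]
      rw [this]
      module
    · rw [if_neg hn, if_neg hn, if_pos (by simpa [Nat.even_add_one] using hn), hA.rep_simple_apply]
      have : (A *ᵥ ((Chebyshev.S ℝ (n - 1)).eval (-2 * A s t) • Pi.single s 1 +
          (Chebyshev.S ℝ n).eval (-2 * A s t) • Pi.single t 1)) s =
          (Chebyshev.S ℝ (n - 1)).eval (-2 * A s t) + (Chebyshev.S ℝ n).eval (-2 * A s t) * A s t := by
        simp [Matrix.mulVec_add, Matrix.mulVec_smul, hA.diag]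
      rw [this]
      module

end Representation

/-! ### Descents and the sign of roots. -/

section Descent

variable {S : Type*} {M : CoxeterMatrix S} {W : Type*} [Group W] (cs : CoxeterSystem M W)

open CoxeterSystem

/-- If `t` is a right descent of `w` and `s` is not, then `w` is a product, with additive lengths,
of an element without the right descents `s` and `t` and of an alternating word in `s` and `t`
that is shorter than the braid word. -/
theorem exists_mul_alternatingWord {w : W} {s t : S} (hs : ¬cs.IsRightDescent w s)
    (ht : cs.IsRightDescent w t) :
    ∃ (v : W) (k : ℕ), v * cs.wordProd (alternatingWord s t k) = w ∧ cs.length v < cs.length w ∧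
      ¬cs.IsRightDescent v s ∧ ¬cs.IsRightDescent v t ∧ (M s t ≠ 0 → k < M s t) := by
  -- Letters `t, s, t, ...` are peeled off the right of `w` as long as the lengths add up; the
  -- maximal number `k` is used.
  let P : ℕ → Prop := fun k => ∃ v : W,
    v * cs.wordProd (alternatingWord s t k) = w ∧ cs.length v + k = cs.length w
  have hP1 : P 1 := ⟨w * cs.simple t, by
    simp [alternatingWord], cs.isRightDescent_iff.1 ht⟩
  have hPle : ∀ k, P k → k ≤ cs.length w := fun k ⟨v, _, h⟩ => by omega
  classical
  set k := Nat.findGreatest P (cs.length w) with hk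
  have hPk : P k := Nat.findGreatest_spec (hPle 1 hP1) hP1
  have hk1 : 1 ≤ k := Nat.le_findGreatest (hPle 1 hP1) hP1
  have hmax : ¬P (k + 1) := fun h => by
    have := Nat.le_findGreatest (hPle _ h) h
    omega
  obtain ⟨v, hv, hlen⟩ := hPk
  have hfirst : ¬cs.IsRightDescent v (if Even k then t else s) := by
    intro hd
    refine hmax ⟨v * cs.simple (if Even k then t else s), ?_, ?_⟩
    · rw [alternatingWord_succ', cs.wordProd_cons, ← mul_assoc, cs.simple_mul_simple_cancel_right,
        hv]
    · have := cs.isRightDescent_iff.1 hd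
      omega
  -- This letter begins the peeled word; as a descent of `v` it would cancel and make `w` shorter
  -- than it is.
  have hsecond : ¬cs.IsRightDescent v (if Even k then s else t) := by
    intro hd
    obtain ⟨n, hn⟩ : ∃ n, k = n + 1 := ⟨k - 1, by omega⟩
    have hpar : (if Even k then s else t) = if Even n then t else s := by
      rw [hn]
      by_cases h : Even n <;> simp [h, Nat.even_add_one]
    rw [hpar] at hd
    rw [hn, alternatingWord_succ', cs.wordProd_cons, ← mul_assoc] at hv
    have h1 := cs.length_mul_le (v * cs.simple (if Even n then t else s))
      (cs.wordProd (alternatingWord s t n))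
    rw [hv] at h1
    have h2 := cs.length_wordProd_le (alternatingWord s t n)
    rw [length_alternatingWord] at h2
    have := cs.isRightDescent_iff.1 hd
    omega
  have hst : ¬cs.IsRightDescent v s ∧ ¬cs.IsRightDescent v t := by
    by_cases h : Even k
    · rw [if_pos h] at hfirst hsecond
      exact ⟨hsecond, hfirst⟩
    · rw [if_neg h] at hfirst hsecond
      exact ⟨hfirst, hsecond⟩
  refine ⟨v, k, hv, by omega, hst.1, hst.2, fun h0 => ?_⟩
  have hred : cs.IsReduced (alternatingWord s t k) := by
    have h1 := cs.length_mul_le v (cs.wordProd (alternatingWord s t k))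
    have h2 := cs.length_wordProd_le (alternatingWord s t k)
    rw [hv] at h1
    rw [length_alternatingWord] at h2
    rw [CoxeterSystem.IsReduced, length_alternatingWord]
    omega
  by_contra hlt
  rcases eq_or_lt_of_le (not_lt.1 hlt) with heq | hgt
  -- If `k = m`, the braid relation rewrites the word to end in `s`, making `s` a descent of `w`.
  · refine hs ?_
    obtain ⟨n, hn⟩ : ∃ n, k = n + 1 := ⟨k - 1, by omega⟩
    have hbraid := cs.wordProd_braidWord_eq s t
    rw [braidWord, braidWord, M.symmetric t s, heq] at hbraid
    rw [hbraid, hn, alternatingWord_succ, cs.wordProd_concat, ← mul_assoc] at hv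
    rw [IsRightDescent]
    nth_rw 1 [← hv]
    rw [cs.simple_mul_simple_cancel_right]
    have h1 := cs.length_mul_le v (cs.wordProd (alternatingWord s t n))
    have h2 := cs.length_wordProd_le (alternatingWord s t n)
    rw [length_alternatingWord] at h2
    omega
  · exact cs.not_isReduced_alternatingWord s t h0 hgt hred

variable [Fintype S] [DecidableEq S] {A : Matrix S S ℝ}

/-- If `s` is not a right descent of `w`, then `w α_s` is a positive root. -/
theorem IsGramMatrix.rep_single_nonneg (hA : IsGramMatrix M A) {w : W} {s : S}
    (hs : ¬cs.IsRightDescent w s) (j : S) : 0 ≤ hA.rep cs w (Pi.single s 1) j := by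
  induction hn : cs.length w using Nat.strong_induction_on generalizing w s with
  | _ n ih =>
    by_cases hw : w = 1
    · subst hw
      rw [map_one, LinearEquiv.coe_one, id_eq]
      exact (Pi.single_nonneg.2 zero_le_one : (0 : S → ℝ) ≤ Pi.single s 1) j
    obtain ⟨t, ht⟩ := cs.exists_rightDescent_of_ne_one hw
    have hst : s ≠ t := by
      rintro rfl
      exact hs ht
    obtain ⟨v, k, hv, hlen, hvs, hvt, hk⟩ := exists_mul_alternatingWord cs hs ht
    have h1 := ih _ (hn ▸ hlen) hvs rfl
    have h2 := ih _ (hn ▸ hlen) hvt rfl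
    -- Both coefficients, with indices `k - 1` and `k`, are nonnegative because `k < m` strictly.
    have c1 := hA.chebyshev_S_nonneg hst k fun h => (hk h).le
    have c2 := hA.chebyshev_S_nonneg hst (k + 1) fun h => hk h
    rw [Nat.cast_add, Nat.cast_one, add_sub_cancel_right] at c2
    rw [← hv, map_mul, LinearEquiv.mul_apply, hA.rep_alternatingWord]
    split_ifs <;>
    · simp only [map_add, map_smul, Pi.add_apply, Pi.smul_apply, smul_eq_mul]
      positivity

theorem IsGramMatrix.rep_single_nonpos (hA : IsGramMatrix M A) {w : W} {s : S}
    (hs : cs.IsRightDescent w s) (j : S) : hA.rep cs w (Pi.single s 1) j ≤ 0 := by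
  have h := hA.rep_single_nonneg cs (cs.isRightDescent_iff_not_isRightDescent_mul.1 hs) j
  rw [hA.rep_mul_simple_single, Pi.neg_apply] at h
  linarith

end Descent

/-! ### Finite parabolic subgroups and positive definite forms. -/

section Finiteness

variable {S : Type*} {M : CoxeterMatrix S} {A : Matrix S S ℝ} {W : Type*} [Group W]

/-- The Coxeter matrix of a standard Coxeter subsystem. -/
def principalCoxeterMatrix (M : CoxeterMatrix S) (I : Finset S) : CoxeterMatrix I where
  M := M.M.submatrix (fun i => (i : S)) (fun i => (i : S))
  isSymm := M.isSymm.submatrix _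
  diagonal i := M.diagonal i
  off_diagonal i j hij := M.off_diagonal i j fun h => hij (Subtype.ext h)

theorem IsGramMatrix.principal (hA : IsGramMatrix M A) (I : Finset S) :
    IsGramMatrix (principalCoxeterMatrix M I) (principal A I) where
  symm := hA.symm.submatrix _
  finite_entry i j := hA.finite_entry i j
  infinite_entry i j := hA.infinite_entry i j

open Filter Topology in
/-- A Coxeter group whose form is positive definite is finite. -/
theorem IsGramMatrix.finite_of_pos [Fintype S] [DecidableEq S] (hA : IsGramMatrix M A)
    (cs : CoxeterSystem M W) (hpos : ∀ x : S → ℝ, x ≠ 0 → 0 < x ⬝ᵥ A *ᵥ x) : Finite W := by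
  rcases isEmpty_or_nonempty S with hS | hS
  · have : ∀ w : W, w = 1 := fun w => by
      by_contra hw
      obtain ⟨i, -⟩ := cs.exists_rightDescent_of_ne_one hw
      exact isEmptyElim i
    have : Subsingleton W := ⟨fun a b => by rw [this a, this b]⟩
    infer_instance
  obtain ⟨z, hz, c, hzc, hc⟩ := exists_isMin_rayleigh A
  have hc0 : 0 < c := by
    have := hpos z hz
    rw [hzc] at this
    exact pos_of_mul_pos_left this (dotProduct_self_pos hz).le
  let m : W → S → S → ℝ := fun w s => hA.rep cs w (Pi.single s 1)
  have hcoord (x : S → ℝ) (j : S) : c * x j ^ 2 ≤ x ⬝ᵥ A *ᵥ x := by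
    refine le_trans (mul_le_mul_of_nonneg_left ?_ hc0.le) (hc x)
    rw [sq]
    exact Finset.single_le_sum (f := fun j => x j * x j) (fun _ _ => mul_self_nonneg _)
      (Finset.mem_univ j)
  -- Every root has form `1`, so its coordinates satisfy `x_j² ≤ 1/c ≤ (1 + 1/c)²`; this radius
  -- avoids a square root.
  have hbound : ∀ w, m w ∈ Metric.closedBall (0 : S → S → ℝ) (1 + 1 / c) := fun w => by
    rw [mem_closedBall_zero_iff, pi_norm_le_iff_of_nonneg (by positivity)]
    intro s
    rw [pi_norm_le_iff_of_nonneg (by positivity)]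
    intro j
    have h1 := hcoord (m w s) j
    rw [hA.form_rep] at h1
    have h2 : Pi.single s (1 : ℝ) ⬝ᵥ A *ᵥ Pi.single s (1 : ℝ) = 1 := by simp [hA.diag]
    rw [h2, mul_comm, ← le_div_iff₀ hc0] at h1
    refine abs_le_of_sq_le_sq ?_ (by positivity)
    have : 0 < 1 / c := by positivity
    nlinarith
  let f : (S → S → ℝ) → ℝ := fun d => ∑ s, d s ⬝ᵥ A *ᵥ d s
  have hf : Continuous f := by
    simp only [f, dotProduct, Matrix.mulVec]
    fun_prop
  -- `w'⁻¹ w` sends some `α_s` to a negative root, which differs from `α_s` by at least `1` in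
  -- coordinate `s`; applying `w'` preserves the form.
  have hsep : ∀ w w' : W, w ≠ w' → c ≤ f (m w - m w') := fun w w' hne => by
    obtain ⟨s, hs⟩ := cs.exists_rightDescent_of_ne_one (w := w'⁻¹ * w) fun h =>
      hne (inv_mul_eq_one.1 h).symm
    have h1 := hA.rep_single_nonpos cs hs s
    set y := hA.rep cs (w'⁻¹ * w) (Pi.single s 1) - Pi.single s 1 with hy
    have hys : y s ≤ -1 := by
      simp only [hy, Pi.sub_apply, Pi.single_eq_same]
      linarith
    have h2 : hA.rep cs w' y = (m w - m w') s := by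
      rw [hy, map_sub, ← LinearEquiv.mul_apply, ← map_mul, mul_inv_cancel_left]
      rfl
    calc c ≤ c * y s ^ 2 := le_mul_of_one_le_right hc0.le (by nlinarith)
      _ ≤ y ⬝ᵥ A *ᵥ y := hcoord y s
      _ = (m w - m w') s ⬝ᵥ A *ᵥ (m w - m w') s := by rw [← h2, hA.form_rep]
      _ ≤ f (m w - m w') := by
        refine Finset.single_le_sum (f := fun s => (m w - m w') s ⬝ᵥ A *ᵥ (m w - m w') s)
          (fun t _ => ?_) (Finset.mem_univ s)
        exact (mul_nonneg hc0.le (Finset.sum_nonneg fun i _ => mul_self_nonneg _)).trans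
          (hc ((m w - m w') t))
  by_contra hfin
  rw [not_finite_iff_infinite] at hfin
  let e := Infinite.natEmbedding W
  obtain ⟨a, -, φ, hφ, hlim⟩ := (isCompact_closedBall (0 : S → S → ℝ) (1 + 1 / c)).tendsto_subseq
    fun n => hbound (e n)
  have h0 : Tendsto (fun n => f (m (e (φ (n + 1))) - m (e (φ n)))) atTop (𝓝 0) := by
    have := (hf.tendsto (a - a)).comp ((hlim.comp (tendsto_add_atTop_nat 1)).sub hlim)
    rwa [show f (a - a) = 0 by simp [f]] at this
  refine hc0.not_ge (ge_of_tendsto' h0 fun n => hsep _ _ fun h => ?_)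
  exact (hφ (Nat.lt_succ_self n)).ne' (e.injective h)

variable [DecidableEq S]

/-- `W_I` is contained in the image of the abstract Coxeter group on `I`; injectivity of that map
plays no role. -/
theorem IsGramMatrix.finite_parabolic (hA : IsGramMatrix M A) (cs : CoxeterSystem M W)
    {I : Finset S} (hI : IsPositive (CoxeterLorentz.principal A I)) :
    Finite (parabolic cs I) := by
  have hfin : Finite (principalCoxeterMatrix M I).Group :=
    (hA.principal I).finite_of_pos (principalCoxeterMatrix M I).toCoxeterSystem (isPositive_iff.1 hI)
  let φ : (principalCoxeterMatrix M I).Group →* W :=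
    (principalCoxeterMatrix M I).toCoxeterSystem.lift
      ⟨fun i => cs.simple i, fun i j => cs.simple_mul_simple_pow (i : S) j⟩
  have hle : parabolic cs I ≤ φ.range := by
    rw [parabolic, Subgroup.closure_le]
    rintro _ ⟨i, hi, rfl⟩
    exact ⟨(principalCoxeterMatrix M I).toCoxeterSystem.simple ⟨i, hi⟩,
      CoxeterSystem.lift_apply_simple _ _ _⟩
  exact Set.Finite.subset (Set.finite_range φ) hle

/-- The inclusion of `ℝ^I` into `ℝ^S`. -/
noncomputable def extendByZero (I : Finset S) : (I → ℝ) →ₗ[ℝ] (S → ℝ) where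
  toFun x i := if h : i ∈ I then x ⟨i, h⟩ else 0
  map_add' x y := by ext i; by_cases h : i ∈ I <;> simp [h]
  map_smul' c x := by ext i; by_cases h : i ∈ I <;> simp [h]

theorem extendByZero_apply_mem (I : Finset S) (x : I → ℝ) (i : I) :
    extendByZero I x i = x i := by
  simp [extendByZero]

theorem extendByZero_apply_notMem {I : Finset S} (x : I → ℝ) {i : S} (hi : i ∉ I) :
    extendByZero I x i = 0 := by
  simp [extendByZero, hi]

theorem extendByZero_eq_zero_iff {I : Finset S} {x : I → ℝ} : extendByZero I x = 0 ↔ x = 0 := by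
  refine ⟨fun h => ?_, fun h => by rw [h, map_zero]⟩
  ext i
  rw [← extendByZero_apply_mem I x i, h]
  rfl

theorem exists_extendByZero_eq {I : Finset S} {v : S → ℝ} (hv : ∀ i ∉ I, v i = 0) :
    ∃ x : I → ℝ, extendByZero I x = v := by
  refine ⟨fun i => v i, funext fun i => ?_⟩
  by_cases hi : i ∈ I
  · exact extendByZero_apply_mem I _ ⟨i, hi⟩
  · rw [extendByZero_apply_notMem _ hi, hv i hi]

variable [Fintype S]

/-- If the parabolic subgroup `W_I` is finite, then no nonzero nonnegative vector `v` supported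
on `I` satisfies `B(v, α_i) ≤ 0` for all `i ∈ I`. -/
theorem IsGramMatrix.eq_zero_of_finite_parabolic (hA : IsGramMatrix M A) (cs : CoxeterSystem M W)
    {I : Finset S} [Finite (parabolic cs I)] {v : S → ℝ} (hv : ∀ i, 0 ≤ v i)
    (hsupp : ∀ i ∉ I, v i = 0) (hAv : ∀ i ∈ I, (A *ᵥ v) i ≤ 0) : v = 0 := by
  classical
  have := Fintype.ofFinite (parabolic cs I)
  let ρ : W → (S → ℝ) → (S → ℝ) := fun w u => hA.rep cs w u
  -- The Euclidean inner product summed over `W_I`, hence `W_I`-invariant.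
  let β : (S → ℝ) → (S → ℝ) → ℝ := fun u u' =>
    ∑ g : parabolic cs I, ρ g u ⬝ᵥ ρ g u'
  have hpos : ∀ u, u ≠ 0 → 0 < β u u := fun u hu =>
    Finset.sum_pos (fun g _ => dotProduct_self_pos ((hA.rep cs (g : W)).map_ne_zero_iff.2 hu))
      ⟨1, Finset.mem_univ 1⟩
  have hinv : ∀ i ∈ I, ∀ u u', β (ρ (cs.simple i) u) (ρ (cs.simple i) u') = β u u' := by
    intro i hi u u'
    let s : parabolic cs I := ⟨cs.simple i, Subgroup.subset_closure ⟨i, hi, rfl⟩⟩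
    refine Fintype.sum_equiv (Equiv.mulRight s) _ _ fun g => ?_
    simp [ρ, s, map_mul, LinearEquiv.mul_apply]
  have hsub : ∀ u u' z (a : ℝ), β (u - a • z) u' = β u u' - a * β z u' := fun u u' z a => by
    simp only [β, ρ, map_sub, map_smul, sub_dotProduct, smul_dotProduct, smul_eq_mul,
      Finset.sum_sub_distrib, Finset.mul_sum]
  have hneg : ∀ u u', β u (-u') = -β u u' := fun u u' => by
    simp only [β, ρ, map_neg, dotProduct_neg, Finset.sum_neg_distrib]
  -- The reflection is `β`-orthogonal and negates `α_i`, so on `α_i` the forms `β` and `B` are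
  -- proportional.
  have hroot : ∀ i ∈ I, ∀ u, β u (Pi.single i 1) =
      (A *ᵥ u) i * β (Pi.single i 1) (Pi.single i 1) := by
    intro i hi u
    have h := hinv i hi u (Pi.single i 1)
    have h1 : ρ (cs.simple i) (Pi.single i 1) = -Pi.single i 1 := by
      have := hA.rep_mul_simple_single cs 1 i
      simpa [ρ] using this
    rw [h1, hneg, show ρ (cs.simple i) u = u - (2 * (A *ᵥ u) i) • Pi.single i 1 from
      hA.rep_simple_apply cs i u, hsub] at h
    linarith
  have hsum : β v v = ∑ i, v i * β v (Pi.single i 1) := by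
    have hexp : v = ∑ i, v i • (Pi.single i 1 : S → ℝ) := by
      ext j
      simp [Finset.sum_apply, Pi.single_apply]
    conv_lhs =>
      arg 2
      rw [hexp]
    simp only [β, ρ, map_sum, map_smul, dotProduct_sum, dotProduct_smul, smul_eq_mul,
      Finset.mul_sum]
    rw [Finset.sum_comm]
  by_contra hv0
  refine (hpos v hv0).not_ge ?_
  rw [hsum]
  refine Finset.sum_nonpos fun i _ => ?_
  by_cases hi : i ∈ I
  · rw [hroot i hi]
    refine mul_nonpos_of_nonneg_of_nonpos (hv i) (mul_nonpos_of_nonpos_of_nonneg (hAv i hi) ?_)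
    exact (hpos _ (by simp)).le
  · rw [hsupp i hi, zero_mul]

theorem mulVec_extendByZero (A : Matrix S S ℝ) {I : Finset S} (x : I → ℝ) (i : I) :
    (A *ᵥ extendByZero I x) i = (principal A I *ᵥ x) i := by
  simp only [Matrix.mulVec, dotProduct]
  rw [← Finset.sum_subset I.subset_univ fun j _ hj => by
    rw [extendByZero_apply_notMem _ hj, mul_zero], ← Finset.sum_coe_sort I]
  exact Finset.sum_congr rfl fun j _ => by rw [extendByZero_apply_mem]; rfl

theorem form_extendByZero (A : Matrix S S ℝ) {I : Finset S} (x : I → ℝ) :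
    extendByZero I x ⬝ᵥ A *ᵥ extendByZero I x = x ⬝ᵥ principal A I *ᵥ x := by
  rw [dotProduct, ← Finset.sum_subset I.subset_univ fun j _ hj => by
    rw [extendByZero_apply_notMem _ hj, zero_mul], ← Finset.sum_coe_sort I]
  exact Finset.sum_congr rfl fun j _ => by rw [extendByZero_apply_mem, mulVec_extendByZero]

/-- A standard parabolic subgroup is finite if and only if its form is positive definite. -/
theorem IsGramMatrix.finite_parabolic_iff (hA : IsGramMatrix M A) (cs : CoxeterSystem M W)
    (I : Finset S) :
    Finite (parabolic cs I) ↔ IsPositive (CoxeterLorentz.principal A I) := by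
  refine ⟨fun hfin => ?_, hA.finite_parabolic cs⟩
  rcases I.eq_empty_or_nonempty with rfl | hne
  · exact isPositive_iff.2 fun x hx => (hx (Subsingleton.elim _ _)).elim
  have := hne.coe_sort
  obtain ⟨v, μ, hv0, hnn, he, hmin⟩ := exists_nonneg_eigenvector (hA.principal I).symm
    (hA.principal I).nonpos
  have hμ : 0 < μ := by
    by_contra! hμ
    refine hv0 (extendByZero_eq_zero_iff.1 (hA.eq_zero_of_finite_parabolic cs (I := I)
      (fun i => ?_) (fun i hi => extendByZero_apply_notMem v hi) fun i hi => ?_))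
    · by_cases hi : i ∈ I
      · exact (hnn ⟨i, hi⟩).trans_eq (extendByZero_apply_mem I v ⟨i, hi⟩).symm
      · exact (extendByZero_apply_notMem v hi).ge
    · rw [mulVec_extendByZero A v ⟨i, hi⟩, he]
      exact mul_nonpos_of_nonpos_of_nonneg hμ (hnn _)
  exact isPositive_iff.2 fun x hx => (mul_pos hμ (dotProduct_self_pos hx)).trans_le (hmin x)

end Finiteness

/-! ### The simplex, the ellipsoid and the three cases. -/

section Geometry

variable {S : Type*} [Fintype S]

theorem height_eq_dotProduct (o v : EuclideanSpace ℝ S) : height o v = o.ofLp ⬝ᵥ v.ofLp := rfl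

theorem height_add (o u v : EuclideanSpace ℝ S) : height o (u + v) = height o u + height o v :=
  dotProduct_add _ _ _

theorem height_smul (o v : EuclideanSpace ℝ S) (c : ℝ) : height o (c • v) = c * height o v :=
  dotProduct_smul _ _ _

theorem height_nonneg {o v : EuclideanSpace ℝ S} (ho : ∀ i, 0 < o i) (hv : ∀ i, 0 ≤ v i) :
    0 ≤ height o v :=
  Finset.sum_nonneg fun i _ => mul_nonneg (ho i).le (hv i)

theorem height_pos {o v : EuclideanSpace ℝ S} (ho : ∀ i, 0 < o i) (hv : ∀ i, 0 ≤ v i)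
    (hv0 : v ≠ 0) : 0 < height o v := by
  refine lt_of_le_of_ne (height_nonneg ho hv) fun h => hv0 ?_
  ext i
  have := (Finset.sum_eq_zero_iff_of_nonneg fun i _ => mul_nonneg (ho i).le (hv i)).1 h.symm i
    (Finset.mem_univ i)
  exact (mul_eq_zero.1 this).resolve_left (ho i).ne'

theorem ne_zero_of_height_eq_one {o v : EuclideanSpace ℝ S} (hv : height o v = 1) : v ≠ 0 := by
  rintro rfl
  simp [height] at hv

variable [DecidableEq S]

theorem q_eq (A : Matrix S S ℝ) (v : EuclideanSpace ℝ S) : q A v = v.ofLp ⬝ᵥ A *ᵥ v.ofLp :=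
  toQuadraticForm'_apply A v.ofLp

theorem normalize_simpleRoot (o : EuclideanSpace ℝ S) (i : S) :
    normalize o (simpleRoot i) = (o i)⁻¹ • EuclideanSpace.single i 1 := by
  simp [normalize, simpleRoot, height]

theorem mem_face_iff {o : EuclideanSpace ℝ S} (ho : ∀ i, 0 < o i) {I : Finset S}
    {v : EuclideanSpace ℝ S} :
    v ∈ face o I ↔ height o v = 1 ∧ (∀ i, 0 ≤ v i) ∧ ∀ i ∉ I, v i = 0 := by
  constructor
  · intro hv
    refine convexHull_min (t := {v | height o v = 1 ∧ (∀ i, 0 ≤ v i) ∧ ∀ i ∉ I, v i = 0}) ?_ ?_ hv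
    · rintro _ ⟨i, hi, rfl⟩
      have hoi := (ho i).ne'
      refine ⟨?_, fun j => ?_, fun j hj => ?_⟩
      · simp [normalize_simpleRoot, height, hoi]
      · simp only [normalize_simpleRoot]
        by_cases hij : j = i <;> simp [hij, (ho i).le]
      · have : j ≠ i := by
          rintro rfl
          exact hj hi
        simp [normalize_simpleRoot, this]
    · rintro u ⟨hu1, hu2, hu3⟩ w ⟨hw1, hw2, hw3⟩ a b ha hb hab
      refine ⟨?_, fun i => ?_, fun i hi => ?_⟩
      · rw [height_add, height_smul, height_smul, hu1, hw1, mul_one, mul_one, hab]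
      · exact add_nonneg (mul_nonneg ha (hu2 i)) (mul_nonneg hb (hw2 i))
      · simp [hu3 i hi, hw3 i hi]
  · rintro ⟨h1, h2, h3⟩
    -- The barycentric weights are `o_i v_i`, summing to the height.
    have hsum : ∑ i ∈ I, (o i * v i) • normalize o (simpleRoot i) = v := by
      ext j
      simp only [normalize_simpleRoot, WithLp.ofLp_sum, Finset.sum_apply, PiLp.smul_apply,
        PiLp.single_apply, smul_eq_mul]
      by_cases hj : j ∈ I
      · rw [Finset.sum_eq_single_of_mem j hj fun i _ hij => by simp [hij.symm]]
        have := (ho j).ne'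
        simp
        field_simp
      · rw [h3 j hj]
        refine Finset.sum_eq_zero fun i hi => ?_
        have : j ≠ i := by
          rintro rfl
          exact hj hi
        simp [this]
    rw [← hsum]
    refine (convex_convexHull ℝ _).sum_mem (fun i _ => mul_nonneg (ho i).le (h2 i)) ?_
      fun i hi => subset_convexHull ℝ _ ⟨i, hi, rfl⟩
    rw [← h1, height]
    exact Finset.sum_subset I.subset_univ fun i _ hi => by rw [h3 i hi, mul_zero]

theorem height_eq_one_of_mem_affineSpan_face {o : EuclideanSpace ℝ S} (ho : ∀ i, 0 < o i)
    {I : Finset S} {v : EuclideanSpace ℝ S} (hv : v ∈ affineSpan ℝ (face o I)) :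
    height o v = 1 := by
  refine affineSpan_induction (p := fun v => height o v = 1) hv
    (fun x hx => ((mem_face_iff ho).1 hx).1) fun c u v w hu hv hw => ?_
  rw [vsub_eq_sub, vadd_eq_add, height_add, height_smul, sub_eq_add_neg, ← neg_one_smul ℝ v,
    height_add, height_smul, hu, hv, hw]
  ring

theorem eq_zero_of_mem_affineSpan_face {o : EuclideanSpace ℝ S} (ho : ∀ i, 0 < o i)
    {I : Finset S} {v : EuclideanSpace ℝ S} (hv : v ∈ affineSpan ℝ (face o I)) {i : S}
    (hi : i ∉ I) : v i = 0 := by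
  refine affineSpan_induction (p := fun v => v i = 0) hv
    (fun x hx => ((mem_face_iff ho).1 hx).2.2 i hi) fun c u v w hu hv hw => ?_
  simp [hu, hv, hw]

/-- The relative interior of the simplex consists of the points with positive coordinates. -/
theorem mem_intrinsicInterior_face_univ {o : EuclideanSpace ℝ S} (ho : ∀ i, 0 < o i)
    {v : EuclideanSpace ℝ S} :
    v ∈ intrinsicInterior ℝ (face o Finset.univ) ↔ height o v = 1 ∧ ∀ i, 0 < v i := by
  constructor
  · intro hv
    have hvf := (mem_face_iff ho).1 (intrinsicInterior_subset hv)
    refine ⟨hvf.1, fun i => lt_of_le_of_ne (hvf.2.1 i) fun h0 => ?_⟩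
    obtain ⟨y, hy, rfl⟩ := mem_intrinsicInterior.1 hv
    have hp : normalize o (simpleRoot i) ∈ affineSpan ℝ (face o Finset.univ) :=
      subset_affineSpan ℝ _ (subset_convexHull ℝ _ ⟨i, by simp, rfl⟩)
    -- The line from `y` towards vertex `i`: since coordinate `i` vanishes at `y`, negative times
    -- leave the simplex.
    let g : ℝ → affineSpan ℝ (face o Finset.univ) := fun t =>
      ⟨AffineMap.lineMap (y : EuclideanSpace ℝ S) (normalize o (simpleRoot i)) t,
        AffineMap.lineMap_mem t y.2 hp⟩
    have hg : Continuous g := by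
      refine Continuous.subtype_mk ?_ _
      exact AffineMap.lineMap_continuous
    have hg0 : g 0 = y := Subtype.ext (AffineMap.lineMap_apply_zero _ _)
    have hev : ∀ᶠ t in nhds (0 : ℝ),
        g t ∈ interior ((↑) ⁻¹' face o Finset.univ : Set (affineSpan ℝ (face o Finset.univ))) :=
      hg.continuousAt.eventually_mem (by rw [hg0]; exact isOpen_interior.mem_nhds hy)
    obtain ⟨t, ht, ht0⟩ := ((hev.filter_mono nhdsWithin_le_nhds).and
      (self_mem_nhdsWithin (s := Set.Iio (0 : ℝ)))).exists
    have hts := interior_subset ht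
    have htf : (g t : EuclideanSpace ℝ S) ∈ face o Finset.univ := hts
    have h1 := ((mem_face_iff ho).1 htf).2.1 i
    have h2 : (g t : EuclideanSpace ℝ S) i = t * (o i)⁻¹ := by
      simp only [g, AffineMap.lineMap_apply_module', normalize_simpleRoot]
      simp [← h0]
    rw [h2] at h1
    exact (mul_neg_of_neg_of_pos ht0 (inv_pos.2 (ho i))).not_ge h1
  · rintro ⟨h1, h2⟩
    have hvf : v ∈ face o Finset.univ := (mem_face_iff ho).2 ⟨h1, fun i => (h2 i).le, by simp⟩
    refine mem_intrinsicInterior.2 ⟨⟨v, subset_affineSpan ℝ _ hvf⟩, ?_, rfl⟩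
    refine mem_interior.2 ⟨{y | ∀ i, 0 < (y : EuclideanSpace ℝ S) i}, fun y hy => ?_, ?_, h2⟩
    · exact (mem_face_iff ho).2
        ⟨height_eq_one_of_mem_affineSpan_face ho y.2, fun i => (hy i).le, by simp⟩
    · simp only [Set.ofPred_forall]
      exact isOpen_iInter_of_finite fun i => isOpen_lt continuous_const (by fun_prop)

/-- A nonzero vector supported on `I` yields a point of the face `F_I` on which the form is not
larger, up to a positive factor. -/
theorem exists_mem_face_q_le {A : Matrix S S ℝ} (hA : ∀ i j, i ≠ j → A i j ≤ 0)
    {o : EuclideanSpace ℝ S} (ho : ∀ i, 0 < o i) {I : Finset S} {x : S → ℝ} (hx : x ≠ 0)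
    (hI : ∀ i ∉ I, x i = 0) : ∃ v ∈ face o I, ∃ c : ℝ, 0 < c ∧ q A v ≤ c * (x ⬝ᵥ A *ᵥ x) := by
  set u : EuclideanSpace ℝ S := WithLp.toLp 2 |x| with hu
  have hu0 : ∀ i, 0 ≤ u i := fun i => abs_nonneg (x i)
  have hh : 0 < height o u := height_pos ho hu0 fun h => hx (by
    have : |x| = 0 := congrArg WithLp.ofLp h
    simpa using this)
  refine ⟨(height o u)⁻¹ • u, (mem_face_iff ho).2 ⟨?_, fun i => ?_, fun i hi => ?_⟩,
    (height o u)⁻¹ ^ 2, by positivity, ?_⟩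
  · rw [height_smul, inv_mul_cancel₀ hh.ne']
  · exact mul_nonneg (inv_pos.2 hh).le (hu0 i)
  · simp [hu, hI i hi]
  · have : q A ((height o u)⁻¹ • u) = (height o u)⁻¹ ^ 2 * (|x| ⬝ᵥ A *ᵥ |x|) := by
      rw [q_eq, WithLp.ofLp_smul, Matrix.mulVec_smul, smul_dotProduct, dotProduct_smul,
        smul_eq_mul, smul_eq_mul]
      ring
    rw [this]
    exact mul_le_mul_of_nonneg_left (abs_dotProduct_mulVec_abs_le hA x) (sq_nonneg _)

theorem isPositive_principal_iff {A : Matrix S S ℝ} {I : Finset S} :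
    IsPositive (principal A I) ↔
      ∀ x : S → ℝ, (∀ i ∉ I, x i = 0) → x ≠ 0 → 0 < x ⬝ᵥ A *ᵥ x := by
  rw [isPositive_iff]
  constructor
  · intro h x hx hx0
    obtain ⟨y, rfl⟩ := exists_extendByZero_eq hx
    rw [form_extendByZero]
    exact h y fun hy => hx0 (by rw [hy, map_zero])
  · intro h y hy
    rw [← form_extendByZero]
    exact h _ (fun i hi => extendByZero_apply_notMem y hi) fun h0 =>
      hy (extendByZero_eq_zero_iff.1 h0)

/-- The restriction of `B(o, ·)`, up to a factor, to the span of the simple roots in `I`. -/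
noncomputable def heightForm (o : EuclideanSpace ℝ S) (I : Finset S) : Module.Dual ℝ (I → ℝ) :=
  dotProductBilin ℝ ℝ o.ofLp ∘ₗ extendByZero I

theorem heightForm_pos {A : Matrix S S ℝ} (hS : A.IsSymm) (hL : IsLorentzian A)
    {o : EuclideanSpace ℝ S} (ho : IsNormalizedEigenvector A o) (I : Finset S) (x : I → ℝ)
    (hx : heightForm o I x = 0) (hx0 : x ≠ 0) : 0 < x ⬝ᵥ principal A I *ᵥ x := by
  obtain ⟨⟨μ, hμ, he⟩, hn, -⟩ := ho
  rw [← form_extendByZero]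
  refine hL.pos_of_dotProduct_eq_zero hS hμ (fun h => ?_) he
    (fun h => hx0 (extendByZero_eq_zero_iff.1 h)) hx
  have : o = 0 := (WithLp.ofLp_eq_zero 2).1 h
  simp [this] at hn

/-- Two positive vectors are not orthogonal, so two candidates share their eigenvalue. The component
of one orthogonal to the other would be a negative eigenvector in the positive definite complement,
hence is zero. -/
theorem existsUnique_isNormalizedEigenvector {A : Matrix S S ℝ} (hS : A.IsSymm)
    (hA : ∀ i j, i ≠ j → A i j ≤ 0) (hirr : IsIndecomposable A) (hL : IsLorentzian A) :
    ∃! o : EuclideanSpace ℝ S, IsNormalizedEigenvector A o := by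
  have hne : Nonempty S := by
    obtain ⟨p, hp, -⟩ := hL
    exact Fintype.card_pos_iff.1 (by omega)
  obtain ⟨v, μ, hv0, hnn, he, hmin⟩ := exists_nonneg_eigenvector hS hA
  have hμ : μ < 0 := by
    by_contra! hμ
    have := sigNeg_eq_zero_iff.2 fun x => (mul_nonneg hμ (by
      exact Finset.sum_nonneg fun i _ => mul_self_nonneg _)).trans (hmin x)
    obtain ⟨p, -, -, h⟩ := hL
    omega
  have hpos := hirr.eigenvector_pos hA hv0 hnn he
  set u : EuclideanSpace ℝ S := WithLp.toLp 2 v with hu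
  have hu0 : 0 < ‖u‖ := norm_pos_iff.2 fun h => hv0 (congrArg WithLp.ofLp h)
  refine ⟨‖u‖⁻¹ • u, ⟨⟨μ, hμ, ?_⟩, ?_, fun i => mul_pos (inv_pos.2 hu0) (hpos i)⟩, ?_⟩
  · rw [WithLp.ofLp_smul, Matrix.mulVec_smul, hu, he, smul_comm]
  · rw [norm_smul, norm_inv, norm_norm, inv_mul_cancel₀ hu0.ne']
  rintro o ⟨⟨ν, hν, hoe⟩, hon, hopos⟩
  have hvo : 0 < v ⬝ᵥ o.ofLp :=
    Finset.sum_pos (fun i _ => mul_pos (hpos i) (hopos i)) Finset.univ_nonempty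
  have hνμ : ν = μ := by
    have h1 := dotProduct_mulVec_symm hS v o.ofLp
    rw [hoe, he, dotProduct_smul, dotProduct_smul, dotProduct_comm o.ofLp v, smul_eq_mul,
      smul_eq_mul] at h1
    exact mul_right_cancel₀ hvo.ne' h1
  subst hνμ
  have hvv := dotProduct_self_pos hv0
  set c := (v ⬝ᵥ o.ofLp) / (v ⬝ᵥ v) with hc
  have hcpos : 0 < c := div_pos hvo hvv
  have hoc : o.ofLp = c • v := by
    by_contra hne
    have h := hL.pos_of_dotProduct_eq_zero hS hμ hv0 he (sub_ne_zero.2 hne) (by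
      rw [dotProduct_sub, dotProduct_smul, smul_eq_mul, hc, div_mul_cancel₀ _ hvv.ne', sub_self])
    rw [Matrix.mulVec_sub, Matrix.mulVec_smul, hoe, he, smul_comm c, ← smul_sub, dotProduct_smul,
      smul_eq_mul] at h
    exact (mul_neg_of_neg_of_pos hμ (dotProduct_self_pos (sub_ne_zero.2 hne))).not_gt h
  have hocu : o = c • u := by
    ext i
    exact congrFun hoc i
  have hcu : c * ‖u‖ = 1 := by
    rw [← hon, hocu, norm_smul, Real.norm_of_nonneg hcpos.le]
  rw [hocu, ← eq_inv_of_mul_eq_one_left hcu]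

/-- The closed ellipsoid lies in the interior of the simplex if and only if all proper principal
submatrices are positive definite. -/
theorem caseInside_iff {A : Matrix S S ℝ} (hS : A.IsSymm) (hA : ∀ i j, i ≠ j → A i j ≤ 0)
    {o : EuclideanSpace ℝ S} (ho : IsNormalizedEigenvector A o) :
    CaseInside A o ↔ ∀ I : Finset S, I ≠ Finset.univ → IsPositive (principal A I) := by
  obtain ⟨⟨μ, hμ, he⟩, hn, hpos⟩ := ho
  constructor
  · intro h I hI
    refine isPositive_principal_iff.2 fun x hx hx0 => ?_
    by_contra! hq
    obtain ⟨v, hv, c, hc, hle⟩ := exists_mem_face_q_le hA hpos hx0 hx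
    obtain ⟨i, hi⟩ : ∃ i, i ∉ I := by
      by_contra! hall
      exact hI (Finset.eq_univ_of_forall hall)
    have hvf := (mem_face_iff hpos).1 hv
    have hqv : q A v ≤ 0 := hle.trans (mul_nonpos_of_nonneg_of_nonpos hc.le hq)
    have hmem : v ∈ openEllipsoid A o ∪ ellipsoid A o :=
      (lt_or_eq_of_le hqv).imp (fun h => ⟨hvf.1, h⟩) fun h => ⟨hvf.1, h⟩
    exact (((mem_intrinsicInterior_face_univ hpos).1 (h hmem)).2 i).ne' (hvf.2.2 i hi)
  · rintro h v hv
    have hv1 : height o v = 1 := hv.elim (·.1) (·.1)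
    have hvq : q A v ≤ 0 := hv.elim (·.2.le) (·.2.le)
    refine (mem_intrinsicInterior_face_univ hpos).2 ⟨hv1, ?_⟩
    by_contra! hneg
    obtain ⟨i, hi⟩ := hneg
    have : Nonempty S := ⟨i⟩
    -- With this `t ≥ 0`, coordinate `k` of `v + t o` vanishes, while `q(v + t o) = q(v) + 2tμ + t²μ
    -- (o ⬝ o) ≤ 0`. The height `1 + t (o ⬝ o)` shows the vector is nonzero.
    obtain ⟨k, hk⟩ := Finite.exists_max fun j => -v j / o j
    set t := -v k / o k with ht
    have ht0 : 0 ≤ t := (div_nonneg (neg_nonneg.2 hi) (hpos i).le).trans (hk i)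
    have hoo : 0 < o.ofLp ⬝ᵥ o.ofLp :=
      Finset.sum_pos (fun j _ => mul_pos (hpos j) (hpos j)) Finset.univ_nonempty
    have hov : o.ofLp ⬝ᵥ v.ofLp = 1 := hv1
    have hxk : (v.ofLp + t • o.ofLp) k = 0 := by
      have := (hpos k).ne'
      simp only [Pi.add_apply, Pi.smul_apply, smul_eq_mul, ht]
      field_simp
      ring
    have hx := isPositive_principal_iff.1 (h (Finset.univ.erase k) (by simp))
      (v.ofLp + t • o.ofLp) (fun j hj => by
        have : j = k := by simpa using hj
        rw [this, hxk]) fun h0 => by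
        have := congrArg (o.ofLp ⬝ᵥ ·) h0
        simp only [dotProduct_add, dotProduct_smul, hov, smul_eq_mul, dotProduct_zero] at this
        nlinarith
    rw [q_eq] at hvq
    have h1 : v.ofLp ⬝ᵥ A *ᵥ o.ofLp = μ := by
      rw [he, dotProduct_smul, dotProduct_comm, hov, smul_eq_mul, mul_one]
    have h2 : o.ofLp ⬝ᵥ A *ᵥ v.ofLp = μ := by rw [dotProduct_mulVec_symm hS, h1]
    have h3 : o.ofLp ⬝ᵥ A *ᵥ o.ofLp = μ * (o.ofLp ⬝ᵥ o.ofLp) := by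
      rw [he, dotProduct_smul, smul_eq_mul]
    simp only [Matrix.mulVec_add, Matrix.mulVec_smul, add_dotProduct, dotProduct_add,
      smul_dotProduct, dotProduct_smul, smul_eq_mul, h1, h2, h3] at hx
    have h4 : t * μ ≤ 0 := mul_nonpos_of_nonneg_of_nonpos ht0 hμ.le
    have h5 : t * (t * (μ * (o.ofLp ⬝ᵥ o.ofLp))) ≤ 0 :=
      mul_nonpos_of_nonneg_of_nonpos ht0 (mul_nonpos_of_nonneg_of_nonpos ht0
        (mul_neg_of_neg_of_pos hμ hoo).le)
    linarith

/-- The face `F_I` is tangent to the ellipsoid if and only if the principal submatrix with index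
set `I` has signature `(|I| - 1, 0)`. -/
theorem isTangentFace_iff {A : Matrix S S ℝ} (hS : A.IsSymm) (hA : ∀ i j, i ≠ j → A i j ≤ 0)
    (hL : IsLorentzian A) {o : EuclideanSpace ℝ S} (ho : IsNormalizedEigenvector A o)
    (I : Finset S) : IsTangentFace A o I ↔ IsAffine (principal A I) := by
  rw [isAffine_iff (heightForm o I) (heightForm_pos hS hL ho I)]
  have hpos := ho.2.2
  constructor
  · rintro ⟨⟨v, hv, hv1, hvq⟩, hD⟩
    refine ⟨fun y => ?_, ?_⟩
    · by_contra! hy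
      have hy0 : extendByZero I y ≠ 0 := fun h0 => by
        rw [extendByZero_eq_zero_iff.1 h0] at hy
        simp at hy
      rw [← form_extendByZero] at hy
      obtain ⟨u, hu, c, hc, hle⟩ := exists_mem_face_q_le hA hpos hy0
        fun i hi => extendByZero_apply_notMem y hi
      have : u ∈ (affineSpan ℝ (face o I) : Set (EuclideanSpace ℝ S)) ∩ openEllipsoid A o :=
        ⟨subset_affineSpan ℝ _ hu, ((mem_face_iff hpos).1 hu).1,
          hle.trans_lt (mul_neg_of_pos_of_neg hc hy)⟩
      rw [hD] at this
      exact this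
    · obtain ⟨y, hy⟩ := exists_extendByZero_eq ((mem_face_iff hpos).1 hv).2.2
      refine ⟨y, fun h0 => ne_zero_of_height_eq_one hv1 ?_, ?_⟩
      · rw [h0, map_zero] at hy
        exact (WithLp.ofLp_eq_zero 2).1 hy.symm
      · rw [← form_extendByZero, hy, ← q_eq, hvq]
  · rintro ⟨hnn, y, hy0, hy⟩
    have hsupp : ∀ v : EuclideanSpace ℝ S, (∀ i ∉ I, v i = 0) → 0 ≤ q A v := fun v hv => by
      obtain ⟨z, hz⟩ := exists_extendByZero_eq hv
      rw [q_eq, ← hz, form_extendByZero]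
      exact hnn z
    constructor
    · obtain ⟨v, hv, c, hc, hle⟩ := exists_mem_face_q_le hA hpos
        (fun h => hy0 (extendByZero_eq_zero_iff.1 h)) fun i hi => extendByZero_apply_notMem y hi
      have hvf := (mem_face_iff hpos).1 hv
      rw [form_extendByZero, hy, mul_zero] at hle
      exact ⟨v, hv, hvf.1, le_antisymm hle (hsupp v hvf.2.2)⟩
    · refine Set.eq_empty_of_forall_notMem fun v hv => ?_
      exact hv.2.2.not_ge (hsupp v fun i hi => eq_zero_of_mem_affineSpan_face hpos hv.1 hi)

theorem IsPositive.principal_mono {A : Matrix S S ℝ} {I J : Finset S} (hIJ : I ⊆ J)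
    (hJ : IsPositive (principal A J)) : IsPositive (principal A I) :=
  isPositive_principal_iff.2 fun x hx =>
    isPositive_principal_iff.1 hJ x fun i hi => hx i fun h => hi (hIJ h)

theorem forall_isPositive_iff_forall_card {A : Matrix S S ℝ} :
    (∀ I : Finset S, I ≠ Finset.univ → IsPositive (principal A I)) ↔
      ∀ I : Finset S, I.card + 1 = Fintype.card S → IsPositive (principal A I) := by
  constructor
  · refine fun h I hI => h I ?_
    rintro rfl
    rw [Finset.card_univ] at hI
    omega
  · intro h I hI
    obtain ⟨i, hi⟩ : ∃ i, i ∉ I := by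
      by_contra! hall
      exact hI (Finset.eq_univ_of_forall hall)
    refine (h (Finset.univ.erase i) ?_).principal_mono fun j hj =>
      Finset.mem_erase.2 ⟨ne_of_mem_of_not_mem hj hi, Finset.mem_univ j⟩
    rw [Finset.card_erase_add_one (Finset.mem_univ i), Finset.card_univ]

end Geometry

end CoxeterLorentz

theorem mainTheorem5 {S : Type*} [Fintype S] [DecidableEq S] {W : Type*} [Group W]
    (M : CoxeterMatrix S) (cs : CoxeterSystem M W) (A : Matrix S S ℝ)
    (hA : CoxeterLorentz.IsGramMatrix M A)
    (hirr : CoxeterLorentz.IsIndecomposable A)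
    (hsig : CoxeterLorentz.IsLorentzian A) :
    (∃! o : EuclideanSpace ℝ S, CoxeterLorentz.IsNormalizedEigenvector A o) ∧
    ∀ o : EuclideanSpace ℝ S, CoxeterLorentz.IsNormalizedEigenvector A o →
      (CoxeterLorentz.CaseInside A o ↔
        ∀ I : Finset S, I.card + 1 = Fintype.card S →
          Finite (CoxeterLorentz.parabolic cs I)) ∧
      (CoxeterLorentz.CaseTangent A o ↔
        ∃ I : Finset S, I ≠ Finset.univ ∧
          CoxeterLorentz.IsAffine (CoxeterLorentz.principal A I)) ∧
      (CoxeterLorentz.CaseRemaining A o ↔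
        (∀ I : Finset S, I ≠ Finset.univ →
          CoxeterLorentz.IsLorentzian (CoxeterLorentz.principal A I) ∨
          CoxeterLorentz.IsPositive (CoxeterLorentz.principal A I)) ∧
        ∃ I : Finset S, I ≠ Finset.univ ∧
          CoxeterLorentz.IsLorentzian (CoxeterLorentz.principal A I)) := by
  open CoxeterLorentz in
  refine ⟨existsUnique_isNormalizedEigenvector hA.symm hA.nonpos hirr hsig, fun o ho => ?_⟩
  have hin := caseInside_iff hA.symm hA.nonpos ho
  have htan : CaseTangent A o ↔ ∃ I : Finset S, I ≠ Finset.univ ∧ IsAffine (principal A I) :=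
    exists_congr fun I => and_congr_right fun _ => isTangentFace_iff hA.symm hA.nonpos hsig ho I
  refine ⟨?_, htan, ?_⟩
  · rw [hin, forall_isPositive_iff_forall_card]
    exact forall₂_congr fun I _ => (hA.finite_parabolic_iff cs I).symm
  -- Positivity on the kernel of the height form leaves only the three types, so excluding the
  -- affine one suffices.
  have htri (I : Finset S) : IsLorentzian (principal A I) ∨ IsPositive (principal A I) ↔
      ¬IsAffine (principal A I) := by
    have hpos := heightForm_pos hA.symm hsig ho I
    rw [isLorentzian_iff _ hpos, isPositive_iff, isAffine_iff _ hpos]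
    constructor
    · rintro (⟨x, hx⟩ | h) ⟨hnn, y, hy0, hy⟩
      · exact hx.not_ge (hnn x)
      · exact (h y hy0).ne' hy
    · intro h
      by_contra! hc
      obtain ⟨hnn, x, hx0, hx⟩ := hc
      exact h ⟨hnn, x, hx0, le_antisymm hx (hnn x)⟩
  have hexcl (I : Finset S) (hI : IsLorentzian (principal A I)) : ¬IsPositive (principal A I) := by
    rintro ⟨-, h0⟩
    obtain ⟨p, -, -, h1⟩ := hI
    omega
  rw [CaseRemaining, hin, htan]
  constructor
  · rintro ⟨hnp, hna⟩
    have hall : ∀ I : Finset S, I ≠ Finset.univ →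
        IsLorentzian (principal A I) ∨ IsPositive (principal A I) :=
      fun I hI => (htri I).2 fun h => hna ⟨I, hI, h⟩
    refine ⟨hall, ?_⟩
    push Not at hnp
    obtain ⟨I, hI, hIp⟩ := hnp
    exact ⟨I, hI, (hall I hI).resolve_right hIp⟩
  · rintro ⟨hall, I, hI, hIL⟩
    exact ⟨fun h => hexcl I hIL (h I hI), fun ⟨J, hJ, hJA⟩ => (htri J).1 (hall J hJ) hJA⟩
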